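/- **Theorem.** Let $\mathcal{V}$ be a Taylor variety, let $\mathbb{A} \in \mathcal{V}$, and let $\theta$ be a congruence of $\mathbb{A}$. Then for every $n \geq 2$, $$[\underbrace{\theta,\dots,\theta}_{n}]_{TC} = [\underbrace{\theta,\dots,\theta}_{n}]_{H}.$$ Here a variety is the class of all algebras of a fixed (finitary) signature that satisfy a given set of identities. It is a *Taylor variety* if it has a Taylor term, i.e. an $m$-ary term $t$ (for some $m$) with $t(x,\dots,x)\approx x$ that satisfies, for each $e<m$, an identity $t(z_{e,0},\dots,z_{e,m-1}) \approx t(w_{e,0},\dots,w_{e,m-1})$ in $\mathcal V$, where all $z_{e,j}, w_{e,j}\in\{x,y\}$, $z_{e,e}=x$ and $w_{e,e}=y$. Let $A$ be the underlying set of $\mathbb A$ and $R\subseteq A^{2^n}$. For $i<n$, the two *faces* of $\gamma\in A^{2^n}$ in direction $i$ are the elements $\gamma^{i,0},\gamma^{i,1}$ of $A^{2^{n\setminus\{i\}}}$ given by $\gamma^{i,b}_f=\gamma_{f\cup\{\langle i,b\rangle\}}$; the pairs $\langle\gamma^{i,0}_f,\gamma^{i,1}_f\rangle$, $f\in 2^{n\setminus\{i\}}$,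 are the *lines* of $\gamma$ in direction $i$. Put $\mathrm{faces}_i(R)=\{\langle\gamma^{i,0},\gamma^{i,1}\rangle:\gamma\in R\}$. The relation $R$ is an *$n$-dimensional tolerance* of $\mathbb A$ if it is compatible with the basic operations of $\mathbb A$ and each binary relation $\mathrm{faces}_i(R)$ is symmetric and quasireflexive ($\langle a,b\rangle$ in the relation implies that $\langle a,a\rangle$ and $\langle b,b\rangle$ are in it); it is an *$n$-dimensional congruence* if in addition each $\mathrm{faces}_i(R)$ is transitive. For congruences $\theta_0,\dots,\theta_{n-1}$ of $\mathbb A$, let $M(\theta_0,\dots,\theta_{n-1})$ and $\Delta(\theta_0,\dots,\theta_{n-1})$ be respectively the least $n$-dimensional tolerance and the least $n$-dimensional congruence of $\mathbb A$ containing all cubes $\mathrm{cube}_i(x,y)$ with $i<n$ and $\langle x,y\rangle\in\theta_i$, where $\mathrm{cube}_i(x,y)_f$ is $x$ if $f_i=0$ and $y$ if $f_i=1$. For a congruence $\delta$ of $\mathbb A$, the relation $R$ has *$(\delta,i)$-centrality* if there is no $\gamma\in R$ such that exactly $2^{n-1}-1$ of the $2^{n-1}$ lines of $\gamma$ in direction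 $i$ are $\delta$-pairs. Finally, $[\theta_0,\dots,\theta_{n-1}]_{TC}$ and $[\theta_0,\dots,\theta_{n-1}]_{H}$ are the meets of all congruences $\delta$ of $\mathbb A$ for which $M(\theta_0,\dots,\theta_{n-1})$, respectively $\Delta(\theta_0,\dots,\theta_{n-1})$, has $(\delta,n-1)$-centrality. -/

import Mathlib

universe u v w

namespace HigherCommutator

/-! ### Varieties and Taylor terms -/

section Varieties

variable {L : FirstOrder.Language.{u, v}}

/-- The algebra `A` satisfies the identity `s ≈ t` in variables from `α`. -/
def SatisfiesIdentity {α : Type*} (A : Type w) [L.Structure A] (s t : L.Term α) : Prop :=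
  ∀ x : α → A, s.realize x = t.realize x

variable (L) in
/-- A variety of `L`-algebras: the class of all algebras satisfying some set of identities. -/
structure Variety where
  Mem : ∀ (A : Type w) [L.Structure A], Prop
  isEquational : ∃ E : Set (L.Term ℕ × L.Term ℕ), ∀ (A : Type w) [L.Structure A],
    Mem A ↔ ∀ e ∈ E, SatisfiesIdentity A e.1 e.2

/-- The identity `s ≈ t` holds in every member of the variety. -/
def Variety.Satisfies {α : Type*} (V : Variety.{u, v, w} L) (s t : L.Term α) : Prop :=
  ∀ (B : Type w) [L.Structure B], V.Mem B → SatisfiesIdentity B s t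

/-- `t` is a Taylor term: it is idempotent and, for each `e`, it satisfies an identity
`t (z e 0, …, z e (m - 1)) ≈ t (w e 0, …, w e (m - 1))` whose entries are the variables
`x = 0` and `y = 1`, with `x` in position `e` on the left and `y` in position `e` on the right. -/
def Variety.IsTaylorTerm (V : Variety.{u, v, w} L) {m : ℕ} (t : L.Term (Fin m)) : Prop :=
  V.Satisfies (t.relabel fun _ => ()) (FirstOrder.Language.Term.var ()) ∧
  ∃ z w : Fin m → Fin m → Fin 2, ∀ e : Fin m,
    z e e = 0 ∧ w e e = 1 ∧ V.Satisfies (t.relabel (z e)) (t.relabel (w e))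

/-- A Taylor variety is a variety with a Taylor term. -/
def Variety.IsTaylor (V : Variety.{u, v, w} L) : Prop :=
  ∃ (m : ℕ) (t : L.Term (Fin m)), V.IsTaylorTerm t

end Varieties

/-! ### The congruence lattice of an algebra -/

section Congruences

variable (L : FirstOrder.Language.{u, v}) (A : Type w) [L.Structure A]

/-- A congruence of the algebra `A`. -/
structure Congruence extends Setoid A where
  compat : ∀ {m : ℕ} (F : L.Functions m) (x y : Fin m → A), (∀ k, toSetoid.r (x k) (y k)) →
    toSetoid.r (FirstOrder.Language.Structure.funMap F x) (FirstOrder.Language.Structure.funMap F y)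

variable {L A}

/-- The pair `⟨a, b⟩` belongs to the congruence `θ`. -/
def Congruence.Rel (θ : Congruence L A) (a b : A) : Prop := θ.toSetoid.r a b

theorem Congruence.toSetoid_injective :
    Function.Injective (Congruence.toSetoid : Congruence L A → Setoid A) := by
  rintro ⟨s, hs⟩ ⟨t, ht⟩ h
  cases h
  rfl

/-- Congruences are ordered by inclusion. -/
instance : PartialOrder (Congruence L A) :=
  PartialOrder.lift Congruence.toSetoid Congruence.toSetoid_injective

/-- The meet of a set of congruences is its intersection. -/
instance : InfSet (Congruence L A) where
  sInf D :=
    { r := fun a b => ∀ δ ∈ D, δ.Rel a b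
      iseqv :=
        { refl := fun a δ _ => δ.toSetoid.iseqv.refl a
          symm := fun h δ hδ => δ.toSetoid.iseqv.symm (h δ hδ)
          trans := fun h h' δ hδ => δ.toSetoid.iseqv.trans (h δ hδ) (h' δ hδ) }
      compat := fun F x y h δ hδ => δ.compat F x y fun k => h k δ hδ }

instance : CompleteLattice (Congruence L A) :=
  completeLatticeOfInf _ fun _ =>
    ⟨fun δ hδ _ _ h => h δ hδ, fun _ hε _ _ h _ hδ => hε hδ h⟩

end Congruences

/-! ### Cubes and higher dimensional relations -/

/-- Labeled cubes `γ ∈ A ^ (2 ^ ι)` with coordinate system `2 ^ ι`. -/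
abbrev Cube (ι : Type*) (A : Type*) : Type _ := (ι → Fin 2) → A

section Cubes

variable {ι : Type*} [DecidableEq ι] {A : Type w}

/-- The vertex `f ∪ {⟨i, b⟩}` of `2 ^ ι`, for a vertex `f` of `2 ^ (ι ∖ {i})`. -/
def insertCoord (i : ι) (b : Fin 2) (f : {j // j ≠ i} → Fin 2) : ι → Fin 2 :=
  fun j => if h : j = i then b else f ⟨j, h⟩

/-- The face of `γ` on which the `i`-th coordinate has the value `b`. -/
def face (i : ι) (b : Fin 2) (γ : Cube ι A) : Cube {j // j ≠ i} A :=
  fun f => γ (insertCoord i b f)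

/-- The set of faces of members of `R` in direction `i`, as a binary relation on cubes of
dimension one less. -/
def facesRel (i : ι) (R : Set (Cube ι A)) (α β : Cube {j // j ≠ i} A) : Prop :=
  ∃ γ ∈ R, face i 0 γ = α ∧ face i 1 γ = β

/-- Quasireflexivity of a binary relation. -/
def QuasiReflexive {B : Type*} (r : B → B → Prop) : Prop :=
  ∀ a b, r a b → r a a ∧ r b b

/-- `R` is compatible with the basic operations of the algebra `A`, acting vertexwise. -/
def Compatible (L : FirstOrder.Language.{u, v}) [L.Structure A] (R : Set (Cube ι A)) : Prop :=
  ∀ {m : ℕ} (F : L.Functions m) (γ : Fin m → Cube ι A), (∀ k, γ k ∈ R) →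
    (fun f => FirstOrder.Language.Structure.funMap F fun k => γ k f) ∈ R

/-- Higher dimensional tolerances of the algebra `A`. -/
structure IsTolerance (L : FirstOrder.Language.{u, v}) [L.Structure A] (R : Set (Cube ι A)) : Prop where
  reflexive : ∀ i, QuasiReflexive (facesRel i R)
  symmetric : ∀ i α β, facesRel i R α β → facesRel i R β α
  compatible : Compatible L R

/-- Higher dimensional congruences of the algebra `A`. -/
structure IsHigherCongruence (L : FirstOrder.Language.{u, v}) [L.Structure A] (R : Set (Cube ι A)) : Prop
    extends IsTolerance L R where
  transitive : ∀ i α β η, facesRel i R α β → facesRel i R β η → facesRel i R α η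

/-- The higher dimensional tolerance generated by `X`. -/
def tolGen (L : FirstOrder.Language.{u, v}) [L.Structure A] (X : Set (Cube ι A)) : Set (Cube ι A) :=
  ⋂₀ {R | IsTolerance L R ∧ X ⊆ R}

/-- The higher dimensional congruence generated by `X`. -/
def congGen (L : FirstOrder.Language.{u, v}) [L.Structure A] (X : Set (Cube ι A)) : Set (Cube ι A) :=
  ⋂₀ {R | IsHigherCongruence L R ∧ X ⊆ R}

/-- The cube whose two faces in direction `i` are constant with values `x` and `y`. -/
def cube (i : ι) (x y : A) : Cube ι A := fun f => if f i = 0 then x else y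

variable {L : FirstOrder.Language.{u, v}} [L.Structure A]

/-- The union over `i` of the images of `θ i` under `cube i`. -/
def generators (θ : ι → Congruence L A) : Set (Cube ι A) :=
  {γ | ∃ i x y, (θ i).Rel x y ∧ γ = cube i x y}

/-- The algebra `M(θ)` of `θ`-matrices. -/
def M (θ : ι → Congruence L A) : Set (Cube ι A) := tolGen L (generators θ)

/-- The higher dimensional congruence `Δ(θ)`. -/
def Delta (θ : ι → Congruence L A) : Set (Cube ι A) := congGen L (generators θ)

/-- `(δ, i)`-centrality: there is no `γ ∈ R` for which exactly `2 ^ (|ι| - 1) - 1` of the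
`2 ^ (|ι| - 1)` lines of `γ` in direction `i` are `δ`-pairs. -/
def HasCentrality [Fintype ι] (δ : Congruence L A) (i : ι) (R : Set (Cube ι A)) : Prop :=
  ¬ ∃ γ ∈ R, {f : {j // j ≠ i} → Fin 2 | δ.Rel (face i 0 γ f) (face i 1 γ f)}.ncard =
    2 ^ (Fintype.card ι - 1) - 1

end Cubes

/-! ### The two higher commutators

The index set is a finite linear order; the centrality condition is imposed in the direction of
its greatest element `⊤`. -/

section Commutators

variable {ι : Type*} [Fintype ι] [LinearOrder ι] [OrderTop ι]
  {L : FirstOrder.Language.{u, v}} {A : Type w} [L.Structure A]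

/-- The term condition commutator `[θ]_TC`. -/
def tcCommutator (θ : ι → Congruence L A) : Congruence L A :=
  sInf {δ | HasCentrality δ ⊤ (M θ)}

/-- The hypercommutator `[θ]_H`. -/
def hyperCommutator (θ : ι → Congruence L A) : Congruence L A :=
  sInf {δ | HasCentrality δ ⊤ (Delta θ)}

end Commutators

end HigherCommutator

namespace HigherCommutator

open Function (update)

/-! ### Term operations, Taylor identities, and exchanging arguments one at a time. -/

section Terms

variable {L : FirstOrder.Language.{u, v}} {A : Type w} [L.Structure A]

/-! Since M(θ,…,θ) ⊆ Δ(θ,…,θ), one inequality is immediate. For the other, δ-centrality must pass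
from M to Δ. By Zorn's lemma, choose a maximal tolerance R among those that contain the generators,
have θ-related vertices and are central (`LineCentral.delta`). If gluing R to itself in any
direction stays in this family, maximality makes R transitive in every direction, so R contains Δ.

Both gluing lemmas use `Congruence.rel_of_forall_exchange`: to get a δ b it suffices that swapping a
for b in one argument of the Taylor term, the others being any mix of a and b, never matters modulo
δ. Across the central direction (`LineCentral.comp_of_ne`), a Taylor identity supplies the δ-lines
on the common face, and the other arguments are then carried from one outer face to the opposite
one. Along the central direction (`LineCentral.comp_self`), centrality becomes a term condition for
polynomials with n - 1 auxiliary θ-variables, and `PolyCentral.of_succ` removes these one by one.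
Only there is it used that all entries of the tuple are equal: an auxiliary θ-pair may be placed in
any coordinate. -/

theorem Congruence.rel_refl (δ : Congruence L A) (a : A) : δ.Rel a a := δ.toSetoid.iseqv.refl a

theorem Congruence.rel_symm (δ : Congruence L A) {a b : A} (h : δ.Rel a b) : δ.Rel b a :=
  δ.toSetoid.iseqv.symm h

theorem Congruence.rel_trans (δ : Congruence L A) {a b c : A} (h : δ.Rel a b) (h' : δ.Rel b c) :
    δ.Rel a c :=
  δ.toSetoid.iseqv.trans h h'

/-- Congruences are preserved by term operations. -/
theorem Congruence.rel_realize (δ : Congruence L A) {α : Type*} (t : L.Term α) {x y : α → A}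
    (h : ∀ k, δ.Rel (x k) (y k)) : δ.Rel (t.realize x) (t.realize y) := by
  induction t with
  | var a => exact h a
  | func F ts ih => exact δ.compat F _ _ ih

/-- Higher dimensional tolerances are preserved by term operations. -/
theorem IsTolerance.realize_mem {ι : Type*} [DecidableEq ι] {R : Set (Cube ι A)}
    (hR : IsTolerance L R) {α : Type*} (t : L.Term α) (γ : α → Cube ι A) (h : ∀ k, γ k ∈ R) :
    (fun f => t.realize fun k => γ k f) ∈ R := by
  induction t with
  | var a => exact h a
  | func F ts ih => exact hR.compatible F _ ih

/-- The Taylor identities, as they hold for the term operation of `t` on a single algebra. -/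
structure IsTaylorOperation (A : Type w) [L.Structure A] {m : ℕ} (t : L.Term (Fin m))
    (z w : Fin m → Fin m → Fin 2) : Prop where
  idem : ∀ a : A, t.realize (fun _ => a) = a
  left : ∀ e, z e e = 0
  right : ∀ e, w e e = 1
  eq : ∀ (e : Fin m) (x : Fin 2 → A),
    t.realize (fun k => x (z e k)) = t.realize (fun k => x (w e k))

theorem Variety.IsTaylor.exists_isTaylorOperation {V : Variety.{u, v, w} L} (hV : V.IsTaylor)
    (hA : V.Mem A) : ∃ (m : ℕ) (t : L.Term (Fin m)) (z w : Fin m → Fin m → Fin 2),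
      IsTaylorOperation A t z w := by
  obtain ⟨m, t, hid, z, w, h⟩ := hV
  refine ⟨m, t, z, w, fun a => ?_, fun e => (h e).1, fun e => (h e).2.1, fun e x => ?_⟩
  · have := hid A hA (fun _ => a)
    simpa [FirstOrder.Language.Term.realize_relabel, Function.comp_def] using this
  · have := (h e).2.2 A hA x
    simpa [FirstOrder.Language.Term.realize_relabel, Function.comp_def] using this

/-- If exchanging `f 0` and `f 1` in any one argument does not change the value of an idempotent
term operation modulo `δ`, then `f 0` and `f 1` are congruent. -/
theorem Congruence.rel_of_forall_exchange (δ : Congruence L A) {m : ℕ} {t : L.Term (Fin m)}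
    (hid : ∀ a : A, t.realize (fun _ => a) = a) (f : Fin 2 → A)
    (h : ∀ (e : Fin m) (c : Fin m → Fin 2),
      δ.Rel (t.realize fun k => if k = e then f 0 else f (c k))
        (t.realize fun k => if k = e then f 1 else f (c k))) :
    δ.Rel (f 0) (f 1) := by
  -- The arguments in `s` have already been switched to `f 1`.
  have key : ∀ s : Finset (Fin m),
      δ.Rel (f 0) (t.realize fun k => f (if k ∈ s then 1 else 0)) := by
    intro s
    induction s using Finset.induction_on with
    | empty => simpa [hid] using δ.rel_refl (f 0)
    | insert e s he ih =>
      refine δ.rel_trans ih ?_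
      convert h e (fun k => if k ∈ s then 1 else 0) using 3 with k k
      · split_ifs <;> simp_all
      · by_cases hk : k = e <;> simp [hk]
  simpa [hid] using key Finset.univ

end Terms

/-! ### Coordinate maps on cubes, and gluing along faces. -/

section CubeOperations

variable {ι : Type*} [DecidableEq ι] {A : Type w}

theorem update_of_eq {h : ι → Fin 2} {i : ι} {b : Fin 2} (hb : h i = b) : update h i b = h := by
  rw [← hb, Function.update_eq_self]

theorem insertCoord_restrict (i : ι) (b : Fin 2) (h : ι → Fin 2) :
    insertCoord i b (fun j => h j) = update h i b := by
  funext j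
  by_cases hj : j = i
  · subst hj; simp [insertCoord]
  · simp [insertCoord, hj]

theorem update_insertCoord (i : ι) (b c : Fin 2) (f : {j // j ≠ i} → Fin 2) :
    update (insertCoord i b f) i c = insertCoord i c f := by
  funext j
  by_cases hj : j = i
  · subst hj; simp [insertCoord]
  · simp [insertCoord, hj]

theorem face_restrict (i : ι) (b : Fin 2) (γ : Cube ι A) (h : ι → Fin 2) :
    face i b γ (fun j => h j) = γ (update h i b) := by
  rw [face, insertCoord_restrict]

theorem face_eq_face_iff {i : ι} {b c : Fin 2} {γ γ' : Cube ι A} :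
    face i b γ = face i c γ' ↔ ∀ h, γ (update h i b) = γ' (update h i c) := by
  constructor
  · intro e h
    have := congrFun e (fun k => h k)
    rwa [face_restrict, face_restrict] at this
  · intro e
    funext f
    have := e (insertCoord i 0 f)
    rwa [update_insertCoord, update_insertCoord] at this

/-- The pullback of a cube along a map acting on the coordinate `i`. -/
def pull (i : ι) (φ : Fin 2 → Fin 2) (γ : Cube ι A) : Cube ι A :=
  fun h => γ (update h i (φ (h i)))

@[simp] theorem pull_update_self (i : ι) (φ : Fin 2 → Fin 2) (γ : Cube ι A) (h : ι → Fin 2)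
    (b : Fin 2) : pull i φ γ (update h i b) = γ (update h i (φ b)) := by
  simp [pull]

theorem pull_update_of_ne {i j : ι} (hij : i ≠ j) (φ : Fin 2 → Fin 2) (γ : Cube ι A)
    (h : ι → Fin 2) (b : Fin 2) :
    pull i φ γ (update h j b) = γ (update (update h i (φ (h i))) j b) := by
  simp [pull, Function.update_of_ne hij, Function.update_comm hij]

@[simp] theorem face_pull (i : ι) (b : Fin 2) (φ : Fin 2 → Fin 2) (γ : Cube ι A) :
    face i b (pull i φ γ) = face i (φ b) γ := by
  rw [face_eq_face_iff]
  simp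

theorem cube_ext_of_face {i : ι} {γ γ' : Cube ι A} (h0 : face i 0 γ = face i 0 γ')
    (h1 : face i 1 γ = face i 1 γ') : γ = γ' := by
  rw [face_eq_face_iff] at h0 h1
  funext h
  have h0 := h0 h
  have h1 := h1 h
  rcases Fin.exists_fin_two.mp ⟨h i, rfl⟩ with e | e
  · rwa [update_of_eq e] at h0
  · rwa [update_of_eq e] at h1

/-- The relation obtained by gluing members of `R` along common faces in direction `j`. -/
def comp (j : ι) (R : Set (Cube ι A)) : Set (Cube ι A) :=
  {γ | ∃ σ ∈ R, ∃ τ ∈ R, face j 1 σ = face j 0 τ ∧ face j 0 γ = face j 0 σ ∧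
    face j 1 γ = face j 1 τ}

variable {L : FirstOrder.Language.{u, v}} [L.Structure A] {R : Set (Cube ι A)}

/-- The four self-maps of a two-element set are the identity, the swap (symmetry) and two constants
(quasireflexivity). With the converse `IsTolerance.of_pull`, tolerances become the compatible
relations closed under `pull`. -/
theorem IsTolerance.pull_mem (hR : IsTolerance L R) (i : ι) (φ : Fin 2 → Fin 2) {γ : Cube ι A}
    (hγ : γ ∈ R) : pull i φ γ ∈ R := by
  have key : facesRel i R (face i (φ 0) γ) (face i (φ 1) γ) := by
    have h : facesRel i R (face i 0 γ) (face i 1 γ) := ⟨γ, hγ, rfl, rfl⟩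
    have hr := hR.reflexive i _ _ h
    have hs := hR.symmetric i _ _ h
    rcases Fin.exists_fin_two.mp ⟨φ 0, rfl⟩ with e0 | e0 <;>
    rcases Fin.exists_fin_two.mp ⟨φ 1, rfl⟩ with e1 | e1 <;>
    rw [e0, e1]
    exacts [hr.1, h, hs, hr.2]
  obtain ⟨η, hη, h0, h1⟩ := key
  rwa [cube_ext_of_face (i := i) (γ := pull i φ γ) (γ' := η) (by simp [h0]) (by simp [h1])]

theorem IsTolerance.of_pull (hc : Compatible L R)
    (hp : ∀ (i : ι) (φ : Fin 2 → Fin 2), ∀ γ ∈ R, pull i φ γ ∈ R) : IsTolerance L R where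
  reflexive := by
    rintro i α β ⟨γ, hγ, rfl, rfl⟩
    exact ⟨⟨_, hp i (fun _ => 0) γ hγ, by simp, by simp⟩,
      ⟨_, hp i (fun _ => 1) γ hγ, by simp, by simp⟩⟩
  symmetric := by
    rintro i α β ⟨γ, hγ, rfl, rfl⟩
    exact ⟨_, hp i (fun b => 1 - b) γ hγ, by simp, by simp⟩
  compatible := hc

theorem IsTolerance.subset_comp (hR : IsTolerance L R) (j : ι) : R ⊆ comp j R := fun γ hγ =>
  ⟨pull j (fun _ => 0) γ, hR.pull_mem j _ hγ, γ, hγ, by simp, by simp, rfl⟩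

theorem face_funMap (i : ι) (b : Fin 2) {m : ℕ} (F : L.Functions m) (γ : Fin m → Cube ι A) :
    face i b (fun f => FirstOrder.Language.Structure.funMap F fun k => γ k f) =
      fun f => FirstOrder.Language.Structure.funMap F fun k => face i b (γ k) f := rfl

theorem IsTolerance.comp (hR : IsTolerance L R) (j : ι) : IsTolerance L (comp j R) := by
  refine IsTolerance.of_pull ?_ ?_
  · intro m F γ h
    choose σ hσ τ hτ h1 h2 h3 using h
    refine ⟨_, hR.compatible F σ hσ, _, hR.compatible F τ hτ, ?_, ?_, ?_⟩ <;>
    simp only [face_funMap, h1, h2, h3]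
  · rintro i φ γ ⟨σ, hσ, τ, hτ, h1, h2, h3⟩
    by_cases hij : i = j
    · subst hij
      rcases Fin.exists_fin_two.mp ⟨φ 0, rfl⟩ with e0 | e0 <;>
      rcases Fin.exists_fin_two.mp ⟨φ 1, rfl⟩ with e1 | e1
      · exact ⟨_, hR.pull_mem i (fun _ => 0) hσ, _, hR.pull_mem i (fun _ => 0) hσ,
          by simp, by simp [e0, h2], by simp [e1, h2]⟩
      · exact ⟨σ, hσ, τ, hτ, h1, by simp [e0, h2], by simp [e1, h3]⟩
      · exact ⟨_, hR.pull_mem i (fun b => 1 - b) hτ, _, hR.pull_mem i (fun b => 1 - b) hσ,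
          by simp [h1], by simp [e0, h3], by simp [e1, h2]⟩
      · exact ⟨_, hR.pull_mem i (fun _ => 1) hτ, _, hR.pull_mem i (fun _ => 1) hτ,
          by simp, by simp [e0, h3], by simp [e1, h3]⟩
    · refine ⟨_, hR.pull_mem i φ hσ, _, hR.pull_mem i φ hτ, ?_, ?_, ?_⟩ <;>
      rw [face_eq_face_iff] at * <;> intro h <;>
      simp only [pull_update_of_ne hij, h1, h2, h3]

theorem transitive_of_comp_subset {j : ι} (h : comp j R ⊆ R)
    (α β η : Cube {k // k ≠ j} A) (h1 : facesRel j R α β) (h2 : facesRel j R β η) :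
    facesRel j R α η := by
  obtain ⟨σ, hσ, rfl, rfl⟩ := h1
  obtain ⟨τ, hτ, hστ, rfl⟩ := h2
  let γ : Cube ι A := fun f => if f j = 0 then σ f else τ f
  have h0 : face j 0 γ = face j 0 σ := by
    rw [face_eq_face_iff]; simp [γ]
  have h1 : face j 1 γ = face j 1 τ := by
    rw [face_eq_face_iff]; simp [γ]
  exact ⟨γ, h ⟨σ, hσ, τ, hτ, hστ.symm, h0, h1⟩, h0, h1⟩

end CubeOperations

/-! ### Centrality and its inheritance under gluing. -/

section Centrality

variable {ι : Type*} [DecidableEq ι] {A : Type w} {L : FirstOrder.Language.{u, v}} [L.Structure A]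

/-- `(δ, i)`-centrality as an implication: if all lines of a member of `R` in direction `i`, except
possibly the one through `v`, are `δ`-pairs, then so is the line through `v`. -/
def LineCentral (δ : Congruence L A) (i : ι) (R : Set (Cube ι A)) : Prop :=
  ∀ γ ∈ R, ∀ v : ι → Fin 2,
    (∀ h : ι → Fin 2, (∃ k, k ≠ i ∧ h k ≠ v k) →
      δ.Rel (γ (update h i 0)) (γ (update h i 1))) →
    δ.Rel (γ (update v i 0)) (γ (update v i 1))

/-- The count says that the set of lines that are not δ-pairs is a singleton. -/
theorem hasCentrality_iff_lineCentral [Fintype ι] (δ : Congruence L A) (i : ι)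
    (R : Set (Cube ι A)) : HasCentrality δ i R ↔ LineCentral δ i R := by
  have hN : Nat.card ({j // j ≠ i} → Fin 2) = 2 ^ (Fintype.card ι - 1) := by
    simp [Fintype.card_subtype_compl]
  have hpos : 0 < 2 ^ (Fintype.card ι - 1) := by positivity
  constructor
  · intro hc γ hγ v hv
    by_contra hn
    refine hc ⟨γ, hγ, ?_⟩
    set S := {f : {j // j ≠ i} → Fin 2 | δ.Rel (face i 0 γ f) (face i 1 γ f)}
    have hS : Sᶜ = {(fun j => v j : {j // j ≠ i} → Fin 2)} := by
      ext f
      simp only [S, Set.mem_compl_iff, Set.mem_ofPred_eq, Set.mem_singleton_iff]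
      constructor
      · intro hf
        by_contra hne
        refine hf ?_
        obtain ⟨k, hk⟩ := Function.ne_iff.mp hne
        have := hv (insertCoord i 0 f) ⟨k, k.2, by simpa [insertCoord, k.2] using hk⟩
        rwa [update_insertCoord, update_insertCoord] at this
      · rintro rfl
        rwa [face_restrict, face_restrict]
    have := Set.ncard_add_ncard_compl S
    rw [hS, Set.ncard_singleton, hN] at this
    omega
  · rintro hc ⟨γ, hγ, hcard⟩
    set S := {f : {j // j ≠ i} → Fin 2 | δ.Rel (face i 0 γ f) (face i 1 γ f)}
    have := Set.ncard_add_ncard_compl S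
    rw [hcard, hN] at this
    obtain ⟨f, hf⟩ := Set.ncard_eq_one.mp (show Sᶜ.ncard = 1 by omega)
    have hfS : f ∉ S := by
      have : f ∈ Sᶜ := by rw [hf]; rfl
      exact this
    refine hfS ?_
    have := hc γ hγ (insertCoord i 0 f) ?_
    · rwa [update_insertCoord, update_insertCoord] at this
    · rintro h ⟨k, hk, hne⟩
      have : (fun j : {j // j ≠ i} => h j) ∈ S := by
        by_contra hS
        have : (fun j : {j // j ≠ i} => h j) ∈ Sᶜ := hS
        rw [hf, Set.mem_singleton_iff] at this
        exact hne (by simp [insertCoord, hk, ← this])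
      simpa only [S, Set.mem_ofPred_eq, face_restrict] using this

theorem LineCentral.mono {δ : Congruence L A} {i : ι} {R S : Set (Cube ι A)}
    (h : LineCentral δ i S) (hRS : R ⊆ S) : LineCentral δ i R := fun γ hγ => h γ (hRS hγ)

theorem lineCentral_sInf {D : Set (Congruence L A)} {i : ι} {R : Set (Cube ι A)}
    (h : ∀ δ ∈ D, LineCentral δ i R) : LineCentral (sInf D) i R :=
  fun γ hγ v hv δ hδ => h δ hδ γ hγ v fun f hf => hv f hf δ hδ

/-- Centrality of `R` in direction `i` is inherited by the gluing of `R` in another direction. -/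
theorem LineCentral.comp_of_ne {R : Set (Cube ι A)} {δ : Congruence L A} {i j : ι} (hij : j ≠ i)
    (hR : IsTolerance L R) (hc : LineCentral δ i R) {m : ℕ} {t : L.Term (Fin m)}
    {z w : Fin m → Fin m → Fin 2} (ht : IsTaylorOperation A t z w) :
    LineCentral δ i (comp j R) := by
  -- Reversing direction `j` exchanges the roles of σ and τ, so the exceptional line may be put on
  -- the outer face of τ.
  suffices H : ∀ σ ∈ R, ∀ τ ∈ R, face j 1 σ = face j 0 τ → ∀ v : ι → Fin 2,
      (∀ h, δ.Rel (σ (update (update h j 0) i 0)) (σ (update (update h j 0) i 1))) →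
      (∀ h, (∃ k, k ≠ i ∧ update h j 1 k ≠ update v j 1 k) →
        δ.Rel (τ (update (update h j 1) i 0)) (τ (update (update h j 1) i 1))) →
      δ.Rel (τ (update (update v j 1) i 0)) (τ (update (update v j 1) i 1)) by
    rintro γ ⟨σ, hσ, τ, hτ, h1, h2, h3⟩ v hv
    rw [face_eq_face_iff] at h2 h3
    have h2' : ∀ h b, γ (update (update h j 0) i b) = σ (update (update h j 0) i b) := by
      intro h b; rw [Function.update_comm hij, h2]
    have h3' : ∀ h b, γ (update (update h j 1) i b) = τ (update (update h j 1) i b) := by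
      intro h b; rw [Function.update_comm hij, h3]
    rcases Fin.exists_fin_two.mp ⟨v j, rfl⟩ with e | e
    · have := H (pull j (fun b => 1 - b) τ) (hR.pull_mem j _ hτ)
        (pull j (fun b => 1 - b) σ) (hR.pull_mem j _ hσ) (by simp [h1]) v ?_ ?_
      · simp only [Function.update_comm hij, pull_update_self] at this
        simp only [Function.update_comm hij.symm] at this
        simp only [sub_self] at this
        rwa [← h2', ← h2', update_of_eq e] at this
      · intro h
        have := hv (update h j 1) ⟨j, hij, by simp [e]⟩
        simp only [h3'] at this
        simpa [Function.update_comm hij] using this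
      · rintro h ⟨k, hk, hne⟩
        have := hv (update h j 0) ⟨k, hk, ?_⟩
        · simp only [h2'] at this
          simpa [Function.update_comm hij] using this
        · by_cases hkj : k = j
          · subst hkj; simp at hne
          · simpa [hkj] using hne
    · have := H σ hσ τ hτ h1 v ?_ ?_
      · rwa [← h3', ← h3', update_of_eq e] at this
      · intro h
        have := hv (update h j 0) ⟨j, hij, by simp [e]⟩
        simpa only [h2'] using this
      · rintro h ⟨k, hk, hne⟩
        have := hv (update h j 1) ⟨k, hk, ?_⟩
        · simpa only [h3'] using this
        · by_cases hkj : k = j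
          · subst hkj; simp at hne
          · simpa [hkj] using hne
  intro σ hσ τ hτ hστ v Hσ Hτ
  rw [face_eq_face_iff] at hστ
  have key : ∀ γ ∈ R,
      (∀ h, δ.Rel (γ (update (update h j 0) i 0)) (γ (update (update h j 0) i 1))) →
      (∀ h, (∃ k, k ≠ i ∧ update h j 1 k ≠ update v j 1 k) →
        δ.Rel (γ (update (update h j 1) i 0)) (γ (update (update h j 1) i 1))) →
      ∀ h, δ.Rel (γ (update (update h j 1) i 0)) (γ (update (update h j 1) i 1)) := by
    intro γ hγ h0 h1 h
    by_cases hh : ∃ k, k ≠ i ∧ update h j 1 k ≠ update v j 1 k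
    · exact h1 h hh
    · push Not at hh
      have heq : ∀ b, update (update h j 1) i b = update (update v j 1) i b := by
        intro b
        funext k
        by_cases hk : k = i
        · subst hk; simp
        · simp only [Function.update_of_ne hk, hh k hk]
      rw [heq, heq]
      refine hc γ hγ _ fun f hf => ?_
      rcases Fin.exists_fin_two.mp ⟨f j, rfl⟩ with e | e
      · simpa only [update_of_eq e] using h0 f
      · simpa only [update_of_eq e] using h1 f (by rwa [update_of_eq e])
  have hστ' : ∀ h b, τ (update (update h j 0) i b) = σ (update (update h j 1) i b) := by
    intro h b; rw [Function.update_comm hij, ← hστ, Function.update_comm hij]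
  have step1 : ∀ (e : Fin m) (c : Fin m → Fin 2) (h : ι → Fin 2),
      δ.Rel (t.realize fun k => if k = e then τ (update (update h j 1) i 0)
          else σ (update (update h j 0) i (c k)))
        (t.realize fun k => if k = e then τ (update (update h j 1) i 1)
          else σ (update (update h j 0) i (c k))) := by
    intro e c h
    have hσc : ∀ (h : ι → Fin 2) b b',
        δ.Rel (σ (update (update h j 0) i b)) (σ (update (update h j 0) i b')) := by
      intro h b b'
      rcases Fin.exists_fin_two.mp ⟨b, rfl⟩ with rfl | rfl <;>
      rcases Fin.exists_fin_two.mp ⟨b', rfl⟩ with rfl | rfl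
      exacts [δ.rel_refl _, Hσ h, δ.rel_symm (Hσ h), δ.rel_refl _]
    -- At `j = 0` all arguments lie on the glued face, so the direction-`i` lines are trivial by the
    -- Taylor identity for `e`. At `j = 1` argument `e` runs along a line of τ, while the others
    -- move only along δ-lines of σ.
    have hmem := hR.realize_mem t
      (fun k => pull i ![z e k, w e k] (if k = e then τ else pull j (fun b => 1 - b) σ))
      (fun k => hR.pull_mem _ _ (by split_ifs; exacts [hτ, hR.pull_mem _ _ hσ]))
    have := key _ hmem ?_ ?_ h
    · simp only [pull_update_self] at this
      refine δ.rel_trans (δ.rel_trans (δ.rel_realize t fun k => ?_) this)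
        (δ.rel_realize t fun k => ?_) <;> split_ifs with hk
      · subst hk; simpa [ht.left] using δ.rel_refl _
      · simpa [Function.update_comm hij] using hσc h _ _
      · subst hk; simpa [ht.right] using δ.rel_refl _
      · simpa [Function.update_comm hij] using hσc h _ _
    · intro h
      have := ht.eq e (fun b => σ (update (update h j 1) i b))
      simp only [pull_update_self]
      convert δ.rel_refl _ using 1
      convert this.symm using 3 with k k
      · split_ifs
        · simp [hστ']
        · simp [Function.update_comm hij]
      · split_ifs
        · simp [hστ']
        · simp [Function.update_comm hij]
    · intro h hh
      simp only [pull_update_self]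
      refine δ.rel_realize t fun k => ?_
      split_ifs with hk
      · subst hk; simpa [ht.left, ht.right] using Hτ h hh
      · simpa [Function.update_comm hij] using hσc h _ _
  have step2 : ∀ (e : Fin m) (c : Fin m → Fin 2) (h : ι → Fin 2),
      δ.Rel (t.realize fun k => if k = e then τ (update (update h j 1) i 0)
          else τ (update (update h j 0) i (c k)))
        (t.realize fun k => if k = e then τ (update (update h j 1) i 1)
          else τ (update (update h j 0) i (c k))) := by
    intro e c h
    -- With argument `e` held on the outer face of τ, the other arguments move through σ to the
    -- glued face; `step1` supplies the lines at `j = 0`.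
    have hmem := hR.realize_mem t
      (fun k => if k = e then pull j (fun _ => 1) τ else pull i (fun _ => c k) σ)
      (fun k => by split_ifs; exacts [hR.pull_mem _ _ hτ, hR.pull_mem _ _ hσ])
    have := key _ hmem ?_ ?_ h
    · simpa [ite_apply, Function.update_comm hij, pull_update_of_ne hij.symm, hστ] using this
    · intro h
      simpa [ite_apply, Function.update_comm hij, pull_update_of_ne hij.symm] using step1 e c h
    · intro h hh
      refine δ.rel_realize t fun k => ?_
      split_ifs with hk
      · simpa [Function.update_comm hij] using Hτ h hh
      · simpa using δ.rel_refl _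
  have step3 : ∀ (e : Fin m) (c : Fin m → Fin 2) (h : ι → Fin 2),
      δ.Rel (t.realize fun k => if k = e then τ (update (update h j 1) i 0)
          else τ (update (update h j 1) i (c k)))
        (t.realize fun k => if k = e then τ (update (update h j 1) i 1)
          else τ (update (update h j 1) i (c k))) := by
    intro e c h
    -- The same move through τ, from the glued face to its outer face.
    have hmem := hR.realize_mem t
      (fun k => if k = e then pull j (fun _ => 1) τ else pull i (fun _ => c k) τ)
      (fun k => by split_ifs; exacts [hR.pull_mem _ _ hτ, hR.pull_mem _ _ hτ])
    have := key _ hmem ?_ ?_ h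
    · simpa [ite_apply, Function.update_comm hij, pull_update_of_ne hij.symm] using this
    · intro h
      simpa [ite_apply, Function.update_comm hij, pull_update_of_ne hij.symm] using step2 e c h
    · intro h hh
      refine δ.rel_realize t fun k => ?_
      split_ifs with hk
      · simpa [Function.update_comm hij] using Hτ h hh
      · simpa using δ.rel_refl _
  exact δ.rel_of_forall_exchange ht.idem (fun b => τ (update (update v j 1) i b))
    fun e c => step3 e c v

/-- The Taylor identities applied to two members `Γ 0` and `Γ 1` of `R` which agree modulo `δ`
outside of the vertex `v`. -/
theorem LineCentral.taylor_step {R : Set (Cube ι A)} {δ : Congruence L A} {i : ι}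
    (hR : IsTolerance L R) (hc : LineCentral δ i R) {m : ℕ} {t : L.Term (Fin m)}
    {z w : Fin m → Fin m → Fin 2} (ht : IsTaylorOperation A t z w) (Γ : Fin 2 → Cube ι A)
    (hΓ : ∀ a, Γ a ∈ R) (v : ι → Fin 2) (hv : ∀ a b, ∀ h ≠ v, δ.Rel (Γ a h) (Γ b h))
    (e : Fin m) (c : Fin m → Fin 2) :
    δ.Rel
      (t.realize fun k => if k = e then Γ 0 v else
        if z e k = 0 then Γ (c k) v else Γ 0 (update v i (v i + 1)))
      (t.realize fun k => if k = e then Γ 1 v else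
        if z e k = 0 then Γ (c k) v else Γ 0 (update v i (v i + 1))) := by
  have hne : ∀ h : ι → Fin 2, (∃ k, k ≠ i ∧ h k ≠ v k) → ∀ b, update h i b ≠ v := by
    rintro h ⟨k, hk, hkv⟩ b rfl
    simp [hk] at hkv
  have hne' : update v i (v i + 1) ≠ v := by
    intro h
    have := congrFun h i
    simp at this
  -- Addition is in `Fin 2`: 0 stays at `v` and 1 goes to the other end of its line. Away from `v`
  -- every `Γ (C k)` may be replaced by `Γ 0` modulo δ, and the Taylor identity then makes the line
  -- a δ-pair.
  have key : ∀ C : Fin m → Fin 2,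
      δ.Rel (t.realize fun k => Γ (C k) (update v i (v i + z e k)))
        (t.realize fun k => Γ (C k) (update v i (v i + w e k))) := by
    intro C
    have := hc _ (hR.realize_mem t
      (fun k => pull i ![v i + z e k, v i + w e k] (Γ (C k)))
      (fun k => hR.pull_mem _ _ (hΓ _))) v ?_
    · simpa using this
    · intro h hh
      have hT := ht.eq e (fun b => Γ 0 (update h i (v i + b)))
      simp only [pull_update_self, Matrix.cons_val_zero, Matrix.cons_val_one]
      refine δ.rel_trans (δ.rel_realize t fun k => hv _ 0 _ (hne h hh _)) ?_
      rw [hT]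
      exact δ.rel_realize t fun k => hv _ _ _ (hne h hh _)
  have left : ∀ a, δ.Rel
      (t.realize fun k => if k = e then Γ a v else
        if z e k = 0 then Γ (c k) v else Γ 0 (update v i (v i + 1)))
      (t.realize fun k => Γ (if k = e then a else c k) (update v i (v i + z e k))) := by
    intro a
    refine δ.rel_realize t fun k => ?_
    by_cases hk : k = e
    · subst hk; simpa [ht.left] using δ.rel_refl _
    · rcases Fin.exists_fin_two.mp ⟨z e k, rfl⟩ with hz | hz
      · simpa [hk, hz] using δ.rel_refl _
      · simpa [hk, hz] using hv _ _ _ hne'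
  -- As `w e e = 1`, argument `e` now sits at the other end of the line, where `Γ 0` and `Γ 1` agree
  -- modulo δ.
  have right : δ.Rel
      (t.realize fun k => Γ (if k = e then 0 else c k) (update v i (v i + w e k)))
      (t.realize fun k => Γ (if k = e then 1 else c k) (update v i (v i + w e k))) := by
    refine δ.rel_realize t fun k => ?_
    by_cases hk : k = e
    · subst hk; simpa [ht.right] using hv _ _ _ hne'
    · simpa [hk] using δ.rel_refl _
  exact δ.rel_trans (left 0) (δ.rel_trans (key _) (δ.rel_trans right
    (δ.rel_symm (δ.rel_trans (left 1) (key _)))))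

/-- Values of polynomial operations of `A`, where one variable ranges over `b 0` and `b 1`, and each
of `k` further variables ranges over the two entries of a `θ`-pair. -/
inductive IsPolyCube (θ : Congruence L A) (b : Fin 2 → A) (k : ℕ) :
    (Fin 2 → (Fin k → Fin 2) → A) → Prop
  | const (c : A) : IsPolyCube θ b k fun _ _ => c
  | fst : IsPolyCube θ b k fun s _ => b s
  | pair (j : Fin k) (c c' : A) (h : θ.Rel c c') :
      IsPolyCube θ b k fun _ y => if y j = 0 then c else c'
  | app {m : ℕ} (F : L.Functions m) (G : Fin m → Fin 2 → (Fin k → Fin 2) → A)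
      (h : ∀ l, IsPolyCube θ b k (G l)) :
      IsPolyCube θ b k fun s y => FirstOrder.Language.Structure.funMap F fun l => G l s y

theorem IsPolyCube.realize {θ : Congruence L A} {b : Fin 2 → A} {k : ℕ} {α : Type*}
    (t : L.Term α) {G : α → Fin 2 → (Fin k → Fin 2) → A} (h : ∀ l, IsPolyCube θ b k (G l)) :
    IsPolyCube θ b k fun s y => t.realize fun l => G l s y := by
  induction t with
  | var a => exact h a
  | func F ts ih => exact .app F _ ih

theorem IsPolyCube.lift {θ : Congruence L A} {b : Fin 2 → A} {k : ℕ}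
    {G : Fin 2 → (Fin k → Fin 2) → A} (h : IsPolyCube θ b k G) :
    IsPolyCube θ b (k + 1) fun s y => G s fun j => y j.castSucc := by
  induction h with
  | const c => exact .const c
  | fst => exact .fst
  | pair j c c' h => exact .pair j.castSucc c c' h
  | app F G h ih => exact .app F _ ih

/-- The term condition for polynomials in one variable ranging over `b 0` and `b 1`, and `k`
variables ranging over `θ`-pairs. -/
def PolyCentral (δ θ : Congruence L A) (b : Fin 2 → A) (k : ℕ) : Prop :=
  ∀ G, IsPolyCube θ b k G → (∀ y ≠ 0, δ.Rel (G 0 y) (G 1 y)) → δ.Rel (G 0 0) (G 1 0)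

/-- Coordinate `i` carries the variable ranging over `b`, and the remaining coordinates carry the
θ-variables; such polynomial cubes are built from generators. -/
theorem polyCentral_of_lineCentral [Fintype ι] {θ δ : Congruence L A} {i : ι}
    {R : Set (Cube ι A)} (hR : IsTolerance L R) (hθ : generators (fun _ => θ) ⊆ R)
    (hc : LineCentral δ i R) (b : Fin 2 → A) (hb : θ.Rel (b 0) (b 1)) :
    PolyCentral δ θ b (Fintype.card ι - 1) := by
  have hcard : Fintype.card {j // j ≠ i} = Fintype.card ι - 1 := by
    simp [Fintype.card_subtype_compl]
  let ε := (Fintype.equivFinOfCardEq hcard).symm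
  intro G hG hy
  have hmem : (fun h => G (h i) fun j => h (ε j) : Cube ι A) ∈ R := by
    clear hy
    induction hG with
    | const c =>
      refine hθ ⟨i, c, c, θ.rel_refl c, ?_⟩
      funext h
      simp [cube]
    | fst =>
      refine hθ ⟨i, b 0, b 1, hb, ?_⟩
      funext h
      rcases Fin.exists_fin_two.mp ⟨h i, rfl⟩ with e | e <;> simp [cube, e]
    | pair j c c' h => exact hθ ⟨ε j, c, c', h, rfl⟩
    | app F G h ih => exact hR.compatible F _ ih
  have := hc _ hmem 0 ?_
  · convert this using 1 <;> simp [(ε _).2] <;> rfl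
  · rintro h ⟨k, hk, hne⟩
    have hupd : ∀ s, (fun j => update h i s (ε j)) = fun j => h (ε j) := by
      intro s; funext j; simp [(ε j).2]
    simp only [hupd, Function.update_self]
    refine hy _ fun h0 => hne ?_
    have := congrFun h0 (ε.symm ⟨k, hk⟩)
    simpa using this

/-- An extra θ-variable deforms the term value to be compared into the one settled by
`LineCentral.taylor_step`, so the condition with `k + 1` variables yields the one with `k`. -/
theorem PolyCentral.of_succ {δ θ : Congruence L A} {b : Fin 2 → A} {k : ℕ} {i : ι}
    {R : Set (Cube ι A)} (hR : IsTolerance L R) (hθ : generators (fun _ => θ) ⊆ R)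
    (hRθ : ∀ γ ∈ R, ∀ h h', θ.Rel (γ h) (γ h')) (hc : LineCentral δ i R)
    {m : ℕ} {t : L.Term (Fin m)} {z w : Fin m → Fin m → Fin 2} (ht : IsTaylorOperation A t z w)
    (γ : Fin 2 → Cube ι A) (hγ : ∀ a, γ a ∈ R) (v : ι → Fin 2)
    (hv : ∀ a c, ∀ h ≠ v, δ.Rel (γ a h) (γ c h))
    (hvθ : ∀ a c, θ.Rel (γ a v) (γ c v)) (hb : ∀ a, γ a v = b a)
    (hk : PolyCentral δ θ b (k + 1)) : PolyCentral δ θ b k := by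
  intro G hG hy
  -- Evaluate the polynomial at the cubes `γ a` in place of `b a`, with all θ-variables set to 0.
  obtain ⟨Γ, hΓ, hΓv, hΓθ, hΓG⟩ : ∃ Γ : Fin 2 → Cube ι A, (∀ a, Γ a ∈ R) ∧
      (∀ a c, ∀ h ≠ v, δ.Rel (Γ a h) (Γ c h)) ∧ (∀ a c, θ.Rel (Γ a v) (Γ c v)) ∧
      ∀ a, Γ a v = G a 0 := by
    have hconst : ∀ c : A, (fun _ => c : Cube ι A) ∈ R := fun c =>
      hθ ⟨i, c, c, θ.rel_refl c, by funext h; simp [cube]⟩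
    clear hy
    induction hG with
    | const c => exact ⟨fun _ _ => c, fun _ => hconst c, fun _ _ _ _ => δ.rel_refl _,
        fun _ _ => θ.rel_refl _, fun _ => rfl⟩
    | fst => exact ⟨γ, hγ, hv, hvθ, hb⟩
    | pair j c c' h =>
      exact ⟨fun _ _ => c, fun _ => hconst c, fun _ _ _ _ => δ.rel_refl _,
        fun _ _ => θ.rel_refl _, fun _ => rfl⟩
    | app F G h ih =>
      choose Γ h1 h2 h3 h4 using ih
      exact ⟨fun a f => FirstOrder.Language.Structure.funMap F fun l => Γ l a f,
        fun a => hR.compatible F _ fun l => h1 l a,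
        fun a c f hf => δ.compat F _ _ fun l => h2 l a c f hf,
        fun a c => θ.compat F _ _ fun l => h3 l a c, fun a => by simp only [h4]⟩
  have hθΓ : ∀ a h, θ.Rel (Γ a v) (Γ 0 h) := fun a h =>
    θ.rel_trans (hΓθ a 0) (hRθ _ (hΓ 0) _ _)
  refine δ.rel_of_forall_exchange ht.idem (fun a => G a 0) fun e c => ?_
  -- At last variable 0, with the others 0, this is the exchange in argument `e`; at 1 it is the
  -- configuration of `LineCentral.taylor_step`.
  let H : Fin m → Fin 2 → (Fin (k + 1) → Fin 2) → A := fun l s y =>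
    if l = e then G s fun j => y j.castSucc else
      if z e l = 0 then G (c l) 0 else
        if y (Fin.last k) = 0 then G (c l) 0 else Γ 0 (update v i (v i + 1))
  have hH : IsPolyCube θ b (k + 1) fun s y => t.realize fun l => H l s y := by
    refine IsPolyCube.realize t fun l => ?_
    by_cases hl : l = e
    · simpa only [H, hl, if_true] using hG.lift
    · by_cases hz : z e l = 0
      · simpa only [H, hl, hz, if_true, if_false] using .const _
      · simp only [H, hl, hz, if_false]
        refine .pair _ _ _ ?_
        rw [← hΓG]
        exact hθΓ _ _
  have := hk _ hH ?_
  · refine δ.rel_trans ?_ (δ.rel_trans this ?_) <;>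
    refine δ.rel_realize t fun l => ?_ <;>
    by_cases hl : l = e <;> by_cases hz : z e l = 0 <;>
    simp only [H, hl, hz, if_true, if_false, Pi.zero_apply] <;> exact δ.rel_refl _
  · intro y hy0
    by_cases hy' : (fun j : Fin k => y j.castSucc) = 0
    · have hlast : y (Fin.last k) ≠ 0 := by
        intro h
        refine hy0 (funext fun j => ?_)
        induction j using Fin.lastCases with
        | last => exact h
        | cast j => exact congrFun hy' j
      have := hc.taylor_step hR ht Γ hΓ v hΓv e c
      simpa only [H, hy', hlast, if_false, hΓG] using this
    · refine δ.rel_realize t fun l => ?_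
      by_cases hl : l = e
      · simpa only [H, hl, if_true] using hy _ hy'
      · simpa only [H, hl, if_false] using δ.rel_refl _

/-- Centrality of `R` in direction `i` is inherited by the gluing of `R` in direction `i`. -/
theorem LineCentral.comp_self [Fintype ι] {R : Set (Cube ι A)} {δ θ : Congruence L A} {i : ι}
    (hR : IsTolerance L R) (hθ : generators (fun _ => θ) ⊆ R)
    (hRθ : ∀ γ ∈ R, ∀ h h', θ.Rel (γ h) (γ h')) (hc : LineCentral δ i R)
    {m : ℕ} {t : L.Term (Fin m)} {z w : Fin m → Fin m → Fin 2} (ht : IsTaylorOperation A t z w) :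
    LineCentral δ i (comp i R) := by
  rintro η ⟨σ, hσ, τ, hτ, h1, h2, h3⟩ v hv
  rw [face_eq_face_iff] at h1 h2 h3
  -- After reversing τ the two cubes coincide at `i = 1`, and the lines of η compare their vertices
  -- at `i = 0`.
  let γ : Fin 2 → Cube ι A := ![σ, pull i (fun b => 1 - b) τ]
  have hγ : ∀ a, γ a ∈ R := by
    intro a
    fin_cases a
    exacts [hσ, hR.pull_mem i _ hτ]
  have hv01 : ∀ h ≠ update v i 0, δ.Rel (γ 0 h) (γ 1 h) := by
    intro h hne
    rcases Fin.exists_fin_two.mp ⟨h i, rfl⟩ with e | e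
    · have := hv h ?_
      · rw [h2, h3, update_of_eq e] at this
        simpa [γ, pull, e] using this
      · by_contra hcon
        push Not at hcon
        refine hne (funext fun k => ?_)
        by_cases hk : k = i
        · subst hk; simp [e]
        · simp [hk, hcon k hk]
    · have := h1 h
      rw [update_of_eq e] at this
      simpa [γ, pull, e, this] using δ.rel_refl _
  have hvγ : ∀ a c, ∀ h ≠ update v i 0, δ.Rel (γ a h) (γ c h) := by
    intro a c h hne
    fin_cases a <;> fin_cases c
    exacts [δ.rel_refl _, hv01 h hne, δ.rel_symm (hv01 h hne), δ.rel_refl _]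
  have hvθ : ∀ a c, θ.Rel (γ a (update v i 0)) (γ c (update v i 0)) := by
    have h : ∀ a, θ.Rel (γ a (update v i 0)) (σ (update v i 1)) := by
      intro a
      convert hRθ (γ a) (hγ a) (update v i 0) (update v i 1) using 1
      fin_cases a
      · rfl
      · simpa [γ] using h1 v
    exact fun a c => θ.rel_trans (h a) (θ.rel_symm (h c))
  have key : ∀ k, k ≤ Fintype.card ι - 1 →
      PolyCentral δ θ (fun a => γ a (update v i 0)) (Fintype.card ι - 1 - k) := by
    intro k
    induction k with
    | zero => exact fun _ => polyCentral_of_lineCentral hR hθ hc _ (hvθ 0 1)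
    | succ k ih =>
      intro hk
      refine PolyCentral.of_succ hR hθ hRθ hc ht γ hγ _ hvγ hvθ (fun _ => rfl) ?_
      rw [show Fintype.card ι - 1 - (k + 1) + 1 = Fintype.card ι - 1 - k by omega]
      exact ih (by omega)
  have := key _ le_rfl
  rw [Nat.sub_self] at this
  -- With no θ-variables left, the hypothesis of the term condition is vacuous.
  have := this _ .fst fun y hy => (hy (Subsingleton.elim _ _)).elim
  rw [h2, h3]
  simpa [γ] using this

end Centrality

/-! ### Generated relations and the maximal central tolerance. -/

section Generation

variable {ι : Type*} [DecidableEq ι] {A : Type w} {L : FirstOrder.Language.{u, v}} [L.Structure A]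

theorem subset_tolGen (X : Set (Cube ι A)) : X ⊆ tolGen L X :=
  Set.subset_sInter fun _ h => h.2

theorem tolGen_subset_congGen (X : Set (Cube ι A)) : tolGen L X ⊆ congGen L X :=
  Set.subset_sInter fun _ h => Set.sInter_subset_of_mem ⟨h.1.toIsTolerance, h.2⟩

theorem isTolerance_tolGen (X : Set (Cube ι A)) : IsTolerance L (tolGen L X) :=
  IsTolerance.of_pull (fun F γ h S hS => hS.1.compatible F γ fun k => h k S hS)
    fun i φ _ hγ S hS => hS.1.pull_mem i φ (hγ S hS)

/-- The cubes all of whose vertices are congruent modulo `θ`. -/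
def blockCubes (ι : Type*) (θ : Congruence L A) : Set (Cube ι A) :=
  {γ | ∀ h h', θ.Rel (γ h) (γ h')}

theorem isTolerance_blockCubes (θ : Congruence L A) : IsTolerance L (blockCubes ι θ) :=
  IsTolerance.of_pull (fun F _ hγ _ _ => θ.compat F _ _ fun k => hγ k _ _)
    fun _ _ _ hγ _ _ => hγ _ _

theorem generators_subset_blockCubes (θ : Congruence L A) :
    generators (fun _ => θ) ⊆ blockCubes ι θ := by
  rintro _ ⟨i, x, y, hxy, rfl⟩ h h'
  simp only [cube]
  split_ifs
  exacts [θ.rel_refl _, hxy, θ.rel_symm hxy, θ.rel_refl _]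

theorem comp_subset_blockCubes [Nonempty ι] {θ : Congruence L A} {R : Set (Cube ι A)}
    (hR : R ⊆ blockCubes ι θ) (j : ι) : comp j R ⊆ blockCubes ι θ := by
  rintro γ ⟨σ, hσ, τ, hτ, h1, h2, h3⟩
  rw [face_eq_face_iff] at h1 h2 h3
  have key : ∀ h, θ.Rel (γ h) (σ (update 0 j 1)) := by
    intro h
    rcases Fin.exists_fin_two.mp ⟨h j, rfl⟩ with e | e
    · rw [← update_of_eq e, h2]
      exact hR hσ _ _
    · rw [← update_of_eq e, h3, h1]
      exact hR hτ _ _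
  exact fun h h' => θ.rel_trans (key h) (θ.rel_symm (key h'))

/-- Operations are finitary, so all arguments already lie in one member of the chain. -/
theorem isTolerance_sUnion {c : Set (Set (Cube ι A))} (hc : IsChain (· ⊆ ·) c) (hne : c.Nonempty)
    (h : ∀ R ∈ c, IsTolerance L R) : IsTolerance L (⋃₀ c) := by
  refine IsTolerance.of_pull ?_ ?_
  · intro m F γ hγ
    choose S hS hγS using hγ
    have : Nonempty c := hne.to_subtype
    have hd : Directed (· ⊆ ·) (Subtype.val : c → Set (Cube ι A)) :=
      (directedOn_iff_directed).mp hc.directedOn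
    obtain ⟨T, hT⟩ := hd.finite_le fun k : Fin m => (⟨S k, hS k⟩ : c)
    exact ⟨T, T.2, (h T T.2).compatible F γ fun k => hT k (hγS k)⟩
  · rintro i φ γ ⟨S, hS, hγ⟩
    exact ⟨S, hS, (h S hS).pull_mem i φ hγ⟩

/-- In the presence of a Taylor operation, the higher dimensional congruence generated by a
constant tuple inherits centrality from the tolerance. -/
theorem LineCentral.delta [Fintype ι] {θ δ : Congruence L A} {i : ι}
    (hc : LineCentral δ i (M fun _ : ι => θ)) {m : ℕ} {t : L.Term (Fin m)}
    {z w : Fin m → Fin m → Fin 2} (ht : IsTaylorOperation A t z w) :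
    LineCentral δ i (Delta fun _ : ι => θ) := by
  have : Nonempty ι := ⟨i⟩
  -- The bound by `blockCubes` keeps vertices θ-related, as gluing in direction `i` requires.
  let 𝓡 : Set (Set (Cube ι A)) :=
    {R | IsTolerance L R ∧ generators (fun _ => θ) ⊆ R ∧ R ⊆ blockCubes ι θ ∧ LineCentral δ i R}
  have hM : M (fun _ : ι => θ) ∈ 𝓡 := ⟨isTolerance_tolGen _, subset_tolGen _,
    Set.sInter_subset_of_mem ⟨isTolerance_blockCubes θ, generators_subset_blockCubes θ⟩, hc⟩
  obtain ⟨R, -, hmax⟩ := zorn_subset_nonempty 𝓡 (fun c hc𝓡 hchain hne =>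
    ⟨⋃₀ c, ⟨isTolerance_sUnion hchain hne fun S hS => (hc𝓡 hS).1,
      hne.elim fun S hS => (hc𝓡 hS).2.1.trans (Set.subset_sUnion_of_mem hS),
      Set.sUnion_subset fun S hS => (hc𝓡 hS).2.2.1,
      fun γ ⟨S, hS, hγ⟩ => (hc𝓡 hS).2.2.2 γ hγ⟩,
      fun S hS => Set.subset_sUnion_of_mem hS⟩) _ hM
  obtain ⟨hT, hgen, hblock, hcent⟩ := hmax.prop
  have hcomp : ∀ j, comp j R ⊆ R := by
    intro j
    refine hmax.le_of_ge ⟨hT.comp j, hgen.trans (hT.subset_comp j),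
      comp_subset_blockCubes hblock j, ?_⟩ (hT.subset_comp j)
    by_cases hj : j = i
    · subst hj
      exact hcent.comp_self hT hgen (fun γ hγ => hblock hγ) ht
    · exact hcent.comp_of_ne hj hT ht
  exact hcent.mono (Set.sInter_subset_of_mem
    ⟨⟨hT, fun j => transitive_of_comp_subset (hcomp j)⟩, hgen⟩)

end Generation

end HigherCommutator

theorem mainTheorem2 {L : FirstOrder.Language.{u, v}} [L.IsAlgebraic]
    (V : HigherCommutator.Variety.{u, v, w} L) (hV : V.IsTaylor)
    (A : Type w) [L.Structure A] (hA : V.Mem A)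
    (θ : HigherCommutator.Congruence L A) (n : ℕ) [NeZero n] (hn : 2 ≤ n) :
    HigherCommutator.tcCommutator (fun _ : Fin n => θ) =
      HigherCommutator.hyperCommutator (fun _ : Fin n => θ) := by
  open HigherCommutator in
  obtain ⟨m, t, z, w, ht⟩ := hV.exists_isTaylorOperation hA
  simp only [tcCommutator, hyperCommutator, hasCentrality_iff_lineCentral]
  apply le_antisymm
  · exact sInf_le_sInf fun δ hδ => LineCentral.mono hδ (tolGen_subset_congGen _)
  -- Centrality survives meets, so M is central for the TC commutator itself, and hence Δ is too.
  · exact sInf_le ((lineCentral_sInf fun δ hδ => hδ).delta ht)
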